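/- Let $d\ge 1$, $Y_d=[0,1)^d$; a function $f$ on $\mathbb R^d$ is called $Y_d$-periodic if $f(x+\kappa)=f(x)$ for all $x\in\mathbb R^d$, $\kappa\in\mathbb Z^d$. A continuous $Y_d$-periodic vector field $b:\mathbb R^d\to\mathbb R^d$ is said to satisfy the gradient invertibility with $v_1$ if $v_1\in C^1(\mathbb R^d)$, $\nabla v_1$ is $Y_d$-periodic, and $b\cdot\nabla v_1=1$ in $\mathbb R^d$. (i) Let $b:\mathbb R^d\to\mathbb R^d$ be continuous and $Y_d$-periodic. Assume that for some $k\in\{1,\dots,d\}$ the component $b_k(x)=b_k(x_k)$ depends only on $x_k$ and is positive on $\mathbb R^d$. Then $b$ satisfies the gradient invertibility with some $v_1$. (ii) Let $b:\mathbb R^d\to\mathbb R^d$ be of class $C^1$ and $Y_d$-periodic, and let $X$ be its flow: $\partial_tX(t,x)=b(X(t,x))$ for $t\in\mathbb R$, $X(0,x)=x$. Assume that there is $u\in C^1(\mathbb R^d)$ such that $\nabla u$ is $Y_d$-periodic, $b\cdot\nabla u>0$ in $Y_d$, and the mapping $$\Phi:(t,x)\longmapsto\frac{D_xX(t,x)\,\nabla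 u(X(t,x))}{(b\cdot\nabla u)(X(t,x))},\qquad D_xX=\big[\partial_{x_i}X_j\big]_{1\le i,j\le d},$$ is bounded and uniformly continuous in $\mathbb R\times\mathbb R^d$. Then $b$ satisfies the gradient invertibility with some $v_1$. (iii) Let $d\ge 2$. There is $\varepsilon_0>0$, depending only on $d$, such that for every $\varepsilon\in(0,\varepsilon_0)$ and all functions $v_1,\dots,v_d\in C^1(\mathbb R^d)$ with $\nabla v_k$ $Y_d$-periodic and $\|\nabla v_k-e_k\|_{L^\infty(Y_d)^d}<\varepsilon$ for $k=1,\dots,d$, where $(e_1,\dots,e_d)$ is the canonical basis, the following holds. The function $\sigma:=\det(\nabla v_1,\dots,\nabla v_d)$ is positive in $\mathbb R^d$, and the vector field $b$ defined by $$\sigma b:=\begin{cases}R_\perp\nabla v_2&\text{if }d=2,\\ \nabla v_2\times\cdots\times\nabla v_d&\text{if }d>2,\end{cases}$$ is continuous, $Y_d$-periodic, and satisfies the gradient invertibility with this same $v_1$. Here $R_\perp$ is the clockwise rotation by $90^\circ$ in $\mathbb R^2$, and the cross product $\xi^2\times\cdots\times\xi^d$ is the vector defined by $\xi^1\cdot(\xi^2\times\cdots\times\xi^d)=\det(\xi^1,\xi^2,\dots,\xi^d)$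 for all $\xi^1\in\mathbb R^d$. -/

import Mathlib

open scoped Gradient ContDiff ENNReal

/-- The Euclidean space `ℝ^d`. -/
abbrev Eucl (d : ℕ) : Type := EuclideanSpace ℝ (Fin d)

/-- The vector of `ℤ^d ⊆ ℝ^d` with coordinates `κ`. -/
noncomputable def latticeVec {d : ℕ} (κ : Fin d → ℤ) : Eucl d :=
  WithLp.toLp 2 (fun i => (κ i : ℝ))

/-- The period cell `Y_d = [0,1)^d`. -/
def unitCell (d : ℕ) : Set (Eucl d) := {x | ∀ i, x i ∈ Set.Ico (0 : ℝ) 1}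

/-- `Y_d`-periodicity: `f (x + κ) = f x` for all `κ ∈ ℤ^d` and `x ∈ ℝ^d`. -/
def YPeriodic {d : ℕ} {F : Type*} (f : Eucl d → F) : Prop :=
  ∀ (κ : Fin d → ℤ) (x : Eucl d), f (x + latticeVec κ) = f x

/-- The vector field `b` satisfies the gradient invertibility with the potential `v`:
`v` is `C^1` on `ℝ^d`, its gradient is `Y_d`-periodic, and `b · ∇v = 1` in `ℝ^d`. -/
def IsGradientInverse {d : ℕ} (b : Eucl d → Eucl d) (v : Eucl d → ℝ) : Prop :=
  ContDiff ℝ 1 v ∧ YPeriodic (∇ v) ∧ ∀ x, inner ℝ (b x) (∇ v x) = 1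

/-- `γ : ℝ → ℝ^d` solves `γ'(t) = b(γ(t))` for all `t ∈ ℝ`, and `γ(0) = x`. -/
def IsTrajectory {d : ℕ} (b : Eucl d → Eucl d) (x : Eucl d) (γ : ℝ → Eucl d) : Prop :=
  γ 0 = x ∧ ∀ t, HasDerivAt γ (b (γ t)) t

open Classical in
/-- The flow `X(t,x)` of `b`: the global solution of `X' = b(X)`, `X(0,x) = x`. It exists and is
unique when `b` is `C^1` and periodic (proved below); the value is a dummy if no global solution
exists. -/
noncomputable def flow {d : ℕ} (b : Eucl d → Eucl d) (t : ℝ) (x : Eucl d) : Eucl d :=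
  if h : ∃ γ, IsTrajectory b x γ then h.choose t else x

/-- `Φ(t,x) = D_xX(t,x) ∇u(X(t,x)) / (b·∇u)(X(t,x))`. In the convention `DU = [∂_{x_i} U_j]_{i,j}`
the matrix `D_xX` is the transpose of the Jacobian matrix, i.e. the matrix of the adjoint of the
Fréchet derivative of `X(t,·)`. -/
noncomputable def hitMap {d : ℕ} (b : Eucl d → Eucl d) (u : Eucl d → ℝ) (p : ℝ × Eucl d) :
    Eucl d :=
  (inner ℝ (b (flow b p.1 p.2)) (∇ u (flow b p.1 p.2)))⁻¹ •
    (ContinuousLinearMap.adjoint (fderiv ℝ (fun y => flow b p.1 y) p.2)) (∇ u (flow b p.1 p.2))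

/-- The matrix whose columns are the given vectors. -/
def colMatrix {d : ℕ} (ξ : Fin d → Eucl d) : Matrix (Fin d) (Fin d) ℝ :=
  Matrix.of fun i j => ξ j i

/-- The clockwise rotation `R_⊥` by 90 degrees in `ℝ²`. -/
noncomputable def rotPerp (ξ : Eucl 2) : Eucl 2 := !₂[ξ 1, -ξ 0]

/-- The cross product of `n` vectors of `ℝ^(n+1)`, characterized by
`ζ · (ξ₁ × ⋯ × ξₙ) = det(ζ, ξ₁, …, ξₙ)`: its `k`-th coordinate is obtained for `ζ = e_k`. -/
noncomputable def crossProd {n : ℕ} (ξ : Fin n → Eucl (n + 1)) : Eucl (n + 1) :=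
  WithLp.toLp 2 fun k =>
    (colMatrix (Fin.cons (EuclideanSpace.single k (1 : ℝ)) ξ : Fin (n + 1) → Eucl (n + 1))).det

/-- In dimension `d = m + 2`, the vector `R_⊥ ξ²` if `d = 2`, and `ξ² × ⋯ × ξᵈ` if `d > 2`. -/
noncomputable def perpProd : {m : ℕ} → (Fin (m + 1) → Eucl (m + 2)) → Eucl (m + 2)
  | 0, ξ => rotPerp (ξ 0)
  | _ + 1, ξ => crossProd ξ

/-! The flow of a periodic `C^1` field is well defined. -/

theorem YPeriodic.exists_bound {d : ℕ} {F : Type*} [NormedAddCommGroup F] {f : Eucl d → F}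
    (hf : YPeriodic f) (hc : Continuous f) : ∃ C : ℝ, ∀ x, ‖f x‖ ≤ C := by
  have hK : IsCompact ((WithLp.toLp 2) ''
      (Set.univ.pi fun _ : Fin d => Set.Icc (0 : ℝ) 1) : Set (Eucl d)) :=
    (isCompact_univ_pi fun _ => isCompact_Icc).image (PiLp.continuous_toLp 2 _)
  obtain ⟨C, hC⟩ := hK.exists_bound_of_continuousOn hc.continuousOn
  refine ⟨C, fun x => ?_⟩
  rw [← hf (fun i => -⌊x i⌋) x]
  refine hC _ ⟨fun i => Int.fract (x i), fun i _ => ⟨Int.fract_nonneg _, (Int.fract_lt_one _).le⟩, ?_⟩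
  ext i
  simp [latticeVec, Int.fract, sub_eq_add_neg]

theorem YPeriodic.exists_lipschitz {d : ℕ} {b : Eucl d → Eucl d}
    (hb : YPeriodic b) (hc : ContDiff ℝ 1 b) : ∃ K : NNReal, LipschitzWith K b := by
  have hp : YPeriodic (fderiv ℝ b) := by
    intro κ x
    rw [← fderiv_comp_add_right]
    congr 1
    funext y
    exact hb κ y
  obtain ⟨C, hC⟩ := hp.exists_bound (hc.continuous_fderiv one_ne_zero)
  refine ⟨C.toNNReal, lipschitzWith_of_nnnorm_fderiv_le (hc.differentiable one_ne_zero) fun x => ?_⟩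
  rw [← NNReal.coe_le_coe, coe_nnnorm]
  exact (hC x).trans (Real.le_coe_toNNReal C)

theorem IsTrajectory.unique {d : ℕ} {b : Eucl d → Eucl d} {K : NNReal} (hK : LipschitzWith K b)
    {x : Eucl d} {γ δ : ℝ → Eucl d} (hγ : IsTrajectory b x γ) (hδ : IsTrajectory b x δ) : γ = δ :=
  ODE_solution_unique_univ (v := fun _ => b) (s := fun _ => Set.univ) (K := K) (t₀ := 0)
    (fun _ => hK.lipschitzOnWith) (fun t => ⟨hγ.2 t, trivial⟩) (fun t => ⟨hδ.2 t, trivial⟩)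
    (hγ.1.trans hδ.1.symm)

theorem exists_isTrajectory {d : ℕ} {b : Eucl d → Eucl d}
    (hb : YPeriodic b) (hc : ContDiff ℝ 1 b) (x : Eucl d) : ∃ γ, IsTrajectory b x γ := by
  obtain ⟨K, hK⟩ := hb.exists_lipschitz hc
  obtain ⟨C, hC⟩ := hb.exists_bound hc.continuous
  have key : ∀ n : ℕ, ∃ γ : ℝ → Eucl d, γ 0 = x ∧
      ∀ t ∈ Set.Ioo (-(n + 1 : ℝ)) (n + 1), HasDerivAt γ (b (γ t)) t := by
    intro n
    have hn : (0 : ℝ) < n + 1 := by positivity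
    have hPL : IsPicardLindelof (fun _ : ℝ => b) (tmin := -(n + 1 : ℝ)) (tmax := n + 1)
        ⟨0, by constructor <;> linarith⟩ x (C.toNNReal * (n + 1)) 0 C.toNNReal K :=
      { lipschitzOnWith := fun _ _ => hK.lipschitzOnWith
        continuousOn := fun _ _ => continuousOn_const
        norm_le := fun _ _ y _ => (hC y).trans (Real.le_coe_toNNReal C)
        mul_max_le := by simp }
    obtain ⟨γ, h0, h1⟩ := hPL.exists_eq_forall_mem_Icc_hasDerivWithinAt₀
    exact ⟨γ, h0, fun t ht =>
      (h1 t (Set.Ioo_subset_Icc_self ht)).hasDerivAt (Icc_mem_nhds ht.1 ht.2)⟩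
  choose γ h0 h1 using key
  have agree : ∀ m n : ℕ, m ≤ n → Set.EqOn (γ m) (γ n) (Set.Ioo (-(m + 1 : ℝ)) (m + 1)) := by
    intro m n hmn
    have hm : (0 : ℝ) < m + 1 := by positivity
    have hmn' : (m : ℝ) ≤ n := by exact_mod_cast hmn
    refine ODE_solution_unique_of_mem_Ioo (v := fun _ => b) (s := fun _ => Set.univ) (K := K)
      (t₀ := 0) (fun _ _ => hK.lipschitzOnWith) ⟨by linarith, hm⟩ (fun t ht => ⟨h1 m t ht, trivial⟩)
      (fun t ht => ⟨h1 n t ⟨by linarith [ht.1], by linarith [ht.2]⟩, trivial⟩) ?_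
    rw [h0, h0]
  refine ⟨fun t => γ ⌈|t|⌉₊ t, by simpa using h0 _, fun t => ?_⟩
  set N : ℕ := ⌈|t|⌉₊ with hN
  have hmem : ∀ s : ℝ, s ∈ Set.Ioo (-((⌈|s|⌉₊ : ℝ) + 1)) (⌈|s|⌉₊ + 1) := fun s => by
    have := Nat.le_ceil |s|
    constructor <;> linarith [neg_abs_le s, le_abs_self s]
  refine (h1 N t (hmem t)).congr_of_eventuallyEq ?_
  filter_upwards [Ioo_mem_nhds (hmem t).1 (hmem t).2] with s hs
  rcases le_total ⌈|s|⌉₊ N with h | h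
  · exact agree _ _ h (hmem s)
  · exact (agree _ _ h hs).symm

theorem isTrajectory_flow {d : ℕ} {b : Eucl d → Eucl d}
    (hb : YPeriodic b) (hc : ContDiff ℝ 1 b) (x : Eucl d) :
    IsTrajectory b x (fun t => flow b t x) := by
  have h := exists_isTrajectory hb hc x
  have e : (fun t => flow b t x) = h.choose := by
    funext t
    simp [flow, h]
  rw [e]
  exact h.choose_spec

/-! For (i), integrate `1 / b_k` in the variable `x_k`. For (iii), pairing the perpendicular product
with `∇v₁` gives `σ`, which is near `det I = 1` when the gradients are near the canonical basis. The
substance is (ii). Since `b·∇u` is bounded below by a positive constant, `u` increases along each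
trajectory from `-∞` to `+∞`, so the trajectory of `x` meets `{u = 0}` at exactly one time `τ(x)`.
As `τ(X(t,x)) = τ(x) - t`, the function `v = -τ` satisfies `b·∇v = 1`, and the implicit function
theorem gives `∇v(x) = Φ(τ(x), x)`, which is bounded and uniformly continuous but in general not
periodic (`exists_potential_of_hitMap`). Periodicity comes from averaging over integer translations,
which preserve `b` and hence the equation. Uniform continuity of the gradient lets differentiability
pass to an ultrafilter limit, and boundedness makes the limit gradient invariant by telescoping
(`exists_averaged_potential`). -/

/-! ### Differentiability of a flow in the initial point -/

section Flow

variable {E : Type*} [NormedAddCommGroup E] [NormedSpace ℝ E]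

/-- On a compact set a `C^1` map is uniformly close to its linearization. -/
theorem IsCompact.exists_uniform_linearization {b : E → E} {b' : E → E →L[ℝ] E}
    (hb : ∀ p, HasFDerivAt b (b' p) p) (hc : Continuous b') {s : Set E} (hs : IsCompact s)
    {ε : ℝ} (hε : 0 < ε) :
    ∃ δ > 0, ∀ p ∈ s, ∀ q, dist q p < δ → ‖b q - b p - b' p (q - p)‖ ≤ ε * ‖q - p‖ := by
  have h := hs.uniformContinuousAt_of_continuousAt b' (fun p _ => hc.continuousAt)
    (Metric.dist_mem_uniformity hε)
  obtain ⟨δ, hδ, H⟩ := Metric.mem_uniformity_dist.1 h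
  refine ⟨δ, hδ, fun p hp q hq => ?_⟩
  refine (convex_ball p δ).norm_image_sub_le_of_norm_hasFDerivWithin_le' (f' := b')
    (fun z _ => (hb z).hasFDerivWithinAt) (fun z hz => ?_) (Metric.mem_ball_self hδ) hq
  have hz' : dist p z < δ := by rw [dist_comm]; exact hz
  have := H hz' hp
  rw [← dist_eq_norm, dist_comm]
  exact le_of_lt this

variable [CompleteSpace E]

/-- Solution of the linearized equation over a short time interval. -/
theorem exists_resolvent_of_small {A : ℝ → E →L[ℝ] E} (hA : Continuous A) {K : NNReal}
    (hK : ∀ t, ‖A t‖ ≤ K) {T : ℝ} (hT : 0 ≤ T) (hKT : 2 * K * T ≤ 1) :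
    ∃ Y : ℝ → E →L[ℝ] E, Y 0 = ContinuousLinearMap.id ℝ E ∧
      ∀ t ∈ Set.Icc 0 T, HasDerivWithinAt Y ((A t).comp (Y t)) (Set.Icc 0 T) t := by
  -- On the unit ball about the identity `‖Y‖ ≤ 2`, so the field has norm at most `2K`, and `2KT ≤
  -- 1` keeps the solution in that ball.
  have hPL : IsPicardLindelof (fun t (Y : E →L[ℝ] E) => (A t).comp Y) (tmin := 0) (tmax := T)
      ⟨0, le_rfl, hT⟩ (ContinuousLinearMap.id ℝ E) 1 0 (2 * K) K :=
    { lipschitzOnWith := fun t _ => by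
        refine LipschitzOnWith.of_dist_le_mul fun Y _ Z _ => ?_
        rw [dist_eq_norm, dist_eq_norm, ← ContinuousLinearMap.comp_sub]
        exact (ContinuousLinearMap.opNorm_comp_le _ _).trans (by gcongr; exact hK t)
      continuousOn := fun Y _ => (hA.clm_comp continuous_const).continuousOn
      norm_le := fun t _ Y hY => by
        have h1 : ‖Y‖ ≤ 2 := by
          have h2 := norm_le_norm_add_norm_sub' Y (ContinuousLinearMap.id ℝ E)
          have h3 := ContinuousLinearMap.norm_id_le (𝕜 := ℝ) (E := E)
          rw [Metric.mem_closedBall, dist_eq_norm] at hY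
          push_cast at hY
          linarith
        refine (ContinuousLinearMap.opNorm_comp_le _ _).trans ?_
        calc ‖A t‖ * ‖Y‖ ≤ K * 2 := by gcongr; exact hK t
          _ = ((2 * K : NNReal) : ℝ) := by push_cast; ring
      mul_max_le := by
        simp only [sub_zero, sub_self, max_eq_left hT]
        push_cast
        linarith }
  exact hPL.exists_eq_forall_mem_Icc_hasDerivWithinAt₀

omit [CompleteSpace E] in
theorem dist_trajectories_le {b : E → E} {K : NNReal} (hK : LipschitzWith K b) {γ δ : ℝ → E}
    (hγ : ∀ t, HasDerivAt γ (b (γ t)) t) (hδ : ∀ t, HasDerivAt δ (b (δ t)) t) {t : ℝ}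
    (ht : 0 ≤ t) : dist (γ t) (δ t) ≤ dist (γ 0) (δ 0) * Real.exp (K * t) := by
  have := dist_le_of_trajectories_ODE (v := fun _ => b) (K := K) (a := 0) (b := t)
    (fun _ => hK)
    (fun s _ => (hγ s).continuousAt.continuousWithinAt) (fun s _ => (hγ s).hasDerivWithinAt)
    (fun s _ => (hδ s).continuousAt.continuousWithinAt) (fun s _ => (hδ s).hasDerivWithinAt)
    le_rfl t ⟨ht, le_rfl⟩
  simpa using this

/-- The derivative is the resolvent `Y T` of the equation linearized along the trajectory of `x`:
the error `X t (x + h) - X t x - Y t h` solves the same linear equation with a source that is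
`o(‖h‖)`, and Grönwall applies. -/
theorem differentiableAt_trajectories_of_small {b : E → E} {b' : E → E →L[ℝ] E}
    (hb : ∀ p, HasFDerivAt b (b' p) p) (hc : Continuous b') {K : NNReal} (hK0 : 0 < K)
    (hK : ∀ p, ‖b' p‖ ≤ K) {X : ℝ → E → E} (hX0 : ∀ x, X 0 x = x)
    (hX : ∀ x t, HasDerivAt (fun s => X s x) (b (X t x)) t) {T : ℝ} (hT : 0 ≤ T)
    (hKT : 2 * K * T ≤ 1) (x : E) : DifferentiableAt ℝ (X T) x := by
  have hXc : ∀ y, Continuous fun t => X t y := fun y =>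
    continuous_iff_continuousAt.2 fun t => (hX y t).continuousAt
  have hLip : LipschitzWith K b := by
    refine lipschitzWith_of_nnnorm_fderiv_le (fun p => (hb p).differentiableAt) fun p => ?_
    rw [(hb p).fderiv]
    exact hK p
  obtain ⟨Y, hY0, hY⟩ := exists_resolvent_of_small (A := fun t => b' (X t x))
    (hc.comp (hXc x)) (fun t => hK _) hT hKT
  have hK0' : (0 : ℝ) < K := hK0
  -- Grönwall turns a source `η * ‖h‖ * exp (K * T)` into an error at most `η * M * ‖h‖`; hence `η =
  -- c / (M + 1)` below.
  set M : ℝ := Real.exp (K * T) * ((Real.exp (K * T) - 1) / K) with hM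
  have hM0 : 0 ≤ M := by
    have : 1 ≤ Real.exp (K * T) := Real.one_le_exp (by positivity)
    have : 0 ≤ Real.exp (K * T) - 1 := by linarith
    positivity
  refine HasFDerivAt.differentiableAt (f' := Y T) ?_
  rw [hasFDerivAt_iff_isLittleO_nhds_zero, Asymptotics.isLittleO_iff]
  intro c hc0
  obtain ⟨δ, hδ, hlin⟩ := (isCompact_Icc (a := (0 : ℝ)) (b := T)).image (hXc x)
    |>.exists_uniform_linearization hb hc (ε := c / (M + 1)) (by positivity)
  filter_upwards [Metric.ball_mem_nhds (0 : E) (ε := δ / Real.exp (K * T)) (by positivity)]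
    with h hh
  rw [mem_ball_zero_iff, lt_div_iff₀ (by positivity)] at hh
  have hdist : ∀ t ∈ Set.Icc 0 T, ‖X t (x + h) - X t x‖ ≤ ‖h‖ * Real.exp (K * T) := by
    intro t ht
    have := dist_trajectories_le hLip (hX (x + h)) (hX x) ht.1
    rw [hX0, hX0, dist_eq_norm, dist_eq_norm, add_sub_cancel_left] at this
    refine this.trans ?_
    gcongr
    exact ht.2
  have hg := norm_le_gronwallBound_of_norm_deriv_right_le (a := 0) (b := T) (δ := 0) (K := K)
    (ε := c / (M + 1) * (‖h‖ * Real.exp (K * T)))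
    (f := fun t => X t (x + h) - X t x - Y t h)
    (f' := fun t => b (X t (x + h)) - b (X t x) - (b' (X t x)) (Y t h))
    (((hXc _).continuousOn.sub (hXc _).continuousOn).sub
      (ContinuousOn.clm_apply (fun t ht => (hY t ht).continuousWithinAt) continuousOn_const))
    (fun t ht => by
      have h1 := (hY t (Set.Ico_subset_Icc_self ht)).mono_of_mem_nhdsWithin
        (Icc_mem_nhdsGE_of_mem ht)
      have h2 := h1.clm_apply (hasDerivWithinAt_const t (Set.Ici t) h)
      simp only [map_zero, add_zero] at h2
      exact ((hX _ t).hasDerivWithinAt.sub (hX _ t).hasDerivWithinAt).sub h2)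
    (by simp [hX0, hY0])
    (fun t ht => by
      have ht' := Set.Ico_subset_Icc_self ht
      have hd := hdist t ht'
      have h1 := hlin (X t x) ⟨t, ht', rfl⟩ (X t (x + h))
        (by rw [dist_eq_norm]; exact hd.trans_lt hh)
      have e : b (X t (x + h)) - b (X t x) - (b' (X t x)) (Y t h) =
          b' (X t x) (X t (x + h) - X t x - Y t h) +
          (b (X t (x + h)) - b (X t x) - b' (X t x) (X t (x + h) - X t x)) := by
        simp only [map_sub]; abel
      rw [e]
      refine (norm_add_le _ _).trans (add_le_add ?_ (h1.trans ?_))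
      · exact ((b' (X t x)).le_opNorm _).trans (by gcongr; exact hK _)
      · gcongr)
    T ⟨hT, le_rfl⟩
  refine hg.trans ?_
  rw [gronwallBound_of_K_ne_0 hK0'.ne']
  simp only [zero_mul, zero_add, sub_zero]
  calc c / (M + 1) * (‖h‖ * Real.exp (K * T)) / K * (Real.exp (K * T) - 1)
      = c * (M / (M + 1)) * ‖h‖ := by rw [hM]; field_simp
    _ ≤ c * 1 * ‖h‖ := by
        gcongr
        rw [div_le_one (by positivity)]
        linarith
    _ = c * ‖h‖ := by ring

/-- The group law writes `X T` as an iterate of `X (T / n)`, with `n` large enough for the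
short-time result. -/
theorem differentiable_trajectories_of_nonneg {b : E → E} {b' : E → E →L[ℝ] E}
    (hb : ∀ p, HasFDerivAt b (b' p) p) (hc : Continuous b') {K : NNReal} (hK0 : 0 < K)
    (hK : ∀ p, ‖b' p‖ ≤ K) {X : ℝ → E → E} (hX0 : ∀ x, X 0 x = x)
    (hX : ∀ x t, HasDerivAt (fun s => X s x) (b (X t x)) t)
    (hadd : ∀ s t x, X (s + t) x = X s (X t x)) {T : ℝ} (hT : 0 ≤ T) :
    Differentiable ℝ (X T) := by
  obtain ⟨n, hn⟩ := exists_nat_gt (2 * K * T)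
  have hn0 : (0 : ℝ) < n := lt_of_le_of_lt (by positivity) hn
  have hs : Differentiable ℝ (X (T / n)) := fun x =>
    differentiableAt_trajectories_of_small hb hc hK0 hK hX0 hX (by positivity)
      (by rw [← mul_div_assoc, div_le_one hn0]; exact hn.le) x
  have key : ∀ m : ℕ, Differentiable ℝ (X (m * (T / n))) := by
    intro m
    induction m with
    | zero =>
      have : X ((0 : ℕ) * (T / n)) = id := by funext x; simp [hX0]
      rw [this]
      exact differentiable_id
    | succ m ih =>
      have : X ((m + 1 : ℕ) * (T / n)) = X (m * (T / n)) ∘ X (T / n) := by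
        funext x
        simp only [Function.comp, ← hadd]
        congr 1
        push_cast
        ring
      rw [this]
      exact ih.comp hs
  have := key n
  rwa [mul_div_cancel₀ _ hn0.ne'] at this

end Flow

/-! ### Regularity of the flow of a periodic field -/

section FlowPeriodic

variable {d : ℕ} {b : Eucl d → Eucl d}

theorem YPeriodic.fderiv {F : Type*} [NormedAddCommGroup F] [NormedSpace ℝ F] {f : Eucl d → F}
    (hf : YPeriodic f) : YPeriodic (fderiv ℝ f) := by
  intro κ x
  rw [← fderiv_comp_add_right]
  congr 1
  funext y
  exact hf κ y

theorem flow_zero (hb : YPeriodic b) (hc : ContDiff ℝ 1 b) (x : Eucl d) : flow b 0 x = x :=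
  (isTrajectory_flow hb hc x).1

theorem hasDerivAt_flow (hb : YPeriodic b) (hc : ContDiff ℝ 1 b) (x : Eucl d) (t : ℝ) :
    HasDerivAt (fun s => flow b s x) (b (flow b t x)) t :=
  (isTrajectory_flow hb hc x).2 t

theorem flow_add (hb : YPeriodic b) (hc : ContDiff ℝ 1 b) (s t : ℝ) (x : Eucl d) :
    flow b (s + t) x = flow b s (flow b t x) := by
  obtain ⟨K, hK⟩ := hb.exists_lipschitz hc
  have h : IsTrajectory b (flow b t x) fun s => flow b (s + t) x :=
    ⟨by simp, fun s => (hasDerivAt_flow hb hc x (s + t)).comp_add_const s t⟩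
  exact congrFun (h.unique hK (isTrajectory_flow hb hc _)) s

theorem differentiable_flow (hb : YPeriodic b) (hc : ContDiff ℝ 1 b) (t : ℝ) :
    Differentiable ℝ (flow b t) := by
  obtain ⟨C, hC⟩ := hb.fderiv.exists_bound (hc.continuous_fderiv one_ne_zero)
  have hd : ∀ p, HasFDerivAt b (fderiv ℝ b p) p := fun p =>
    (hc.differentiable one_ne_zero p).hasFDerivAt
  -- The added 1 makes the constant positive, since the Grönwall bound divides by it.
  have hK0 : 0 < C.toNNReal + 1 := by positivity
  have hK : ∀ p, ‖fderiv ℝ b p‖ ≤ (C.toNNReal + 1 : NNReal) := fun p => by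
    have := (hC p).trans (Real.le_coe_toNNReal C)
    push_cast
    linarith
  have hcont := hc.continuous_fderiv one_ne_zero
  rcases le_total 0 t with ht | ht
  · exact differentiable_trajectories_of_nonneg hd hcont hK0 hK (flow_zero hb hc)
      (hasDerivAt_flow hb hc) (flow_add hb hc) ht
  -- For negative times, the reversed flow is the flow of `-b`.
  · have := differentiable_trajectories_of_nonneg (b := fun p => -b p)
      (b' := fun p => -fderiv ℝ b p) (X := fun s => flow b (-s)) (fun p => (hd p).neg) hcont.neg
      hK0 (fun p => by rw [norm_neg]; exact hK p) (fun x => by simp [flow_zero hb hc])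
      (fun x s => by
        have h := (hasDerivAt_flow hb hc x (-s)).scomp s (hasDerivAt_neg s)
        rw [neg_one_smul] at h
        exact h)
      (fun r s x => by rw [neg_add, flow_add hb hc]) (neg_nonneg.2 ht)
    simpa using this

theorem continuous_uncurry_flow (hb : YPeriodic b) (hc : ContDiff ℝ 1 b) :
    Continuous fun p : ℝ × Eucl d => flow b p.1 p.2 := by
  obtain ⟨C, hC⟩ := hb.exists_bound hc.continuous
  refine continuous_prod_of_continuous_lipschitzWith (fun p : ℝ × Eucl d => flow b p.1 p.2)
    C.toNNReal (fun t => (differentiable_flow hb hc t).continuous) fun x => ?_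
  refine lipschitzWith_of_nnnorm_deriv_le
    (fun t => (hasDerivAt_flow hb hc x t).differentiableAt) fun t => ?_
  rw [(hasDerivAt_flow hb hc x t).deriv, ← NNReal.coe_le_coe, coe_nnnorm]
  exact (hC _).trans (Real.le_coe_toNNReal C)

end FlowPeriodic

/-! ### The hitting time of a level set -/

theorem strictMono_and_exists_zero_of_le_deriv {g g' : ℝ → ℝ} (hg : ∀ t, HasDerivAt g (g' t) t)
    {c : ℝ} (hc : 0 < c) (h : ∀ t, c ≤ g' t) : StrictMono g ∧ ∃ t, g t = 0 := by
  have hd : Differentiable ℝ g := fun t => (hg t).differentiableAt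
  have hle : ∀ t, c ≤ deriv g t := fun t => by rw [(hg t).deriv]; exact h t
  have key : ∀ s t, s ≤ t → c * (t - s) ≤ g t - g s := fun s t hst =>
    mul_sub_le_image_sub_of_le_deriv hd hle hst
  refine ⟨strictMono_of_deriv_pos fun t => hc.trans_le (hle t), ?_⟩
  have hr : 0 ≤ |g 0| / c := by positivity
  have e : c * (|g 0| / c) = |g 0| := by field_simp
  refine mem_range_of_exists_le_of_exists_ge hd.continuous ⟨-(|g 0| / c), ?_⟩ ⟨|g 0| / c, ?_⟩
  · have := key (-(|g 0| / c)) 0 (by linarith)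
    rw [zero_sub, neg_neg, e] at this
    linarith [le_abs_self (g 0)]
  · have := key 0 (|g 0| / c) hr
    rw [sub_zero, e] at this
    linarith [neg_abs_le (g 0)]

theorem YPeriodic.exists_pos_le {d : ℕ} {f : Eucl d → ℝ} (hf : YPeriodic f) (hc : Continuous f)
    (hpos : ∀ x ∈ unitCell d, 0 < f x) : ∃ c > 0, ∀ x, c ≤ f x := by
  have hp : ∀ x, 0 < f x := fun x => by
    rw [← hf (fun i => -⌊x i⌋) x]
    refine hpos _ fun i => ?_
    have : (x + latticeVec fun i => -⌊x i⌋) i = Int.fract (x i) := by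
      simp [latticeVec, Int.fract, sub_eq_add_neg]
    rw [this]
    exact ⟨Int.fract_nonneg _, Int.fract_lt_one _⟩
  -- An upper bound for the continuous periodic function `1 / f` is a lower bound for `f`.
  have hi : YPeriodic fun x => (f x)⁻¹ := fun κ x => by simp only [hf κ x]
  obtain ⟨C, hC⟩ := hi.exists_bound (hc.inv₀ fun x => (hp x).ne')
  have hC' : ∀ x, (f x)⁻¹ ≤ C := fun x => (le_abs_self _).trans (hC x)
  have hC0 : 0 < C := (inv_pos.2 (hp 0)).trans_le (hC' 0)
  exact ⟨C⁻¹, inv_pos.2 hC0, fun x => inv_le_of_inv_le₀ (hp x) (hC' x)⟩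

/-- If `f(x, t)` has continuous partial derivatives, is increasing in `t`, and vanishes
exactly at `t = τ(x)`, then `τ` is differentiable and its gradient is the usual quotient. -/
theorem hasGradientAt_of_implicit {E : Type*} [NormedAddCommGroup E] [InnerProductSpace ℝ E]
    [CompleteSpace E] {f : E → ℝ → ℝ} {w : E → ℝ → ℝ} {Φ : E → ℝ → E}
    (hx : ∀ x t, HasGradientAt (fun y => f y t) (w x t • Φ x t) x)
    (ht : ∀ x t, HasDerivAt (f x) (w x t) t)
    (hw : Continuous fun p : E × ℝ => w p.1 p.2) (hΦ : Continuous fun p : E × ℝ => Φ p.1 p.2)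
    (hw0 : ∀ x t, w x t ≠ 0) (hinj : ∀ x, Function.Injective (f x)) {τ : E → ℝ}
    (hτ : ∀ x, f x (τ x) = 0) (x : E) : HasGradientAt (fun y => -τ y) (Φ x (τ x)) x := by
  set f₁ : E → ℝ → E →L[ℝ] ℝ := fun y t => InnerProductSpace.toDual ℝ E (w y t • Φ y t) with hf₁
  set f₂ : E → ℝ → ℝ →L[ℝ] ℝ := fun y t => ContinuousLinearMap.toSpanSingleton ℝ (w y t) with hf₂
  have df₁ : ∀ᶠ v in nhds (x, τ x), HasFDerivAt (f · v.2) (f₁ v.1 v.2) v.1 :=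
    Filter.Eventually.of_forall fun v => (hx v.1 v.2).hasFDerivAt
  have df₂ : ∀ᶠ v in nhds (x, τ x), HasFDerivAt (f v.1 ·) (f₂ v.1 v.2) v.2 :=
    Filter.Eventually.of_forall fun v => (ht v.1 v.2).hasFDerivAt
  have cf₁ : ContinuousAt ↿f₁ (x, τ x) :=
    ((InnerProductSpace.toDual ℝ E).continuous.comp (hw.smul hΦ)).continuousAt
  have cf₂ : ContinuousAt ↿f₂ (x, τ x) := by
    have : Continuous fun a : ℝ => ContinuousLinearMap.toSpanSingleton ℝ a :=
      (ContinuousLinearMap.toSpanSingletonCLE (𝕜 := ℝ) (E := ℝ)).continuous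
    exact (this.comp hw).continuousAt
  have inv : (f₂ (x, τ x).1 (x, τ x).2).IsInvertible := by
    refine ⟨ContinuousLinearEquiv.unitsEquivAut ℝ (Units.mk0 _ (hw0 x (τ x))), ?_⟩
    ext
    simp [hf₂]
  have hψ := hasStrictFDerivAt_implicitFunctionOfBivariate df₁ df₂ cf₁ cf₂ inv
  have hev := eventually_apply_implicitFunctionOfBivariate df₁ df₂ cf₁ cf₂ inv
  -- Injectivity in `t` identifies `τ` with the local implicit function, so no continuity of `τ` is
  -- needed beforehand.
  have heq : τ =ᶠ[nhds x] implicitFunctionOfBivariate df₁ df₂ cf₁ cf₂ inv := by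
    filter_upwards [hev] with y hy
    refine hinj y ?_
    rw [hy, hτ, hτ]
  have hd := (hψ.hasFDerivAt.congr_of_eventuallyEq heq).neg
  rw [hasGradientAt_iff_hasFDerivAt]
  refine hd.congr_fderiv ?_
  rw [neg_neg]
  ext h
  have h1 := DFunLike.congr_fun inv.self_comp_inverse (f₁ x (τ x) h)
  simp only [hf₁, hf₂, ContinuousLinearMap.comp_apply, ContinuousLinearMap.toSpanSingleton_apply,
    ContinuousLinearMap.id_apply, InnerProductSpace.toDual_apply_apply, real_inner_smul_left,
    smul_eq_mul] at h1 ⊢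
  rw [mul_comm] at h1
  exact mul_left_cancel₀ (hw0 _ _) h1

section HitTime

variable {d : ℕ} {b : Eucl d → Eucl d} {u : Eucl d → ℝ}

/-- The chain rule gives the numerator of `Φ`. Its denominator is the time derivative of `u` along
the flow, so the implicit quotient will be exactly `Φ`. -/
theorem hasGradientAt_comp_flow (hb : YPeriodic b) (hc : ContDiff ℝ 1 b) (hu : ContDiff ℝ 1 u)
    {t : ℝ} {x : Eucl d} (h0 : inner ℝ (b (flow b t x)) (∇ u (flow b t x)) ≠ 0) :
    HasGradientAt (fun y => u (flow b t y))
      (inner ℝ (b (flow b t x)) (∇ u (flow b t x)) • hitMap b u (t, x)) x := by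
  have h1 := (hu.differentiable one_ne_zero (flow b t x)).hasFDerivAt.comp x
    (differentiable_flow hb hc t x).hasFDerivAt
  rw [hasGradientAt_iff_hasFDerivAt]
  refine h1.congr_fderiv ?_
  ext h
  simp only [hitMap, smul_inv_smul₀ h0]
  simp only [InnerProductSpace.toDual_apply_apply, ContinuousLinearMap.adjoint_inner_left,
    ContinuousLinearMap.comp_apply, inner_gradient_left]

/-- The opposite of the time at which the flow reaches the level set `{u = 0}`. -/
theorem exists_potential_of_hitMap (hc : ContDiff ℝ 1 b) (hb : YPeriodic b)
    (hu : ContDiff ℝ 1 u) (hup : YPeriodic (∇ u))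
    (hpos : ∀ x ∈ unitCell d, 0 < inner ℝ (b x) (∇ u x)) {C : ℝ}
    (hC : ∀ p, ‖hitMap b u p‖ ≤ C) (hΦ : UniformContinuous (hitMap b u)) :
    ∃ (v : Eucl d → ℝ) (g : Eucl d → Eucl d), (∀ x, HasGradientAt v (g x) x) ∧
      (∀ x, ‖g x‖ ≤ C) ∧ UniformContinuous g ∧ ∀ x, inner ℝ (b x) (g x) = 1 := by
  have hgc : Continuous (∇ u) :=
    (InnerProductSpace.toDual ℝ (Eucl d)).symm.continuous.comp (hu.continuous_fderiv one_ne_zero)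
  have hwc : Continuous fun x => inner ℝ (b x) (∇ u x) := hc.continuous.inner hgc
  obtain ⟨c, hc0, hcle⟩ := YPeriodic.exists_pos_le
    (f := fun x => inner ℝ (b x) (∇ u x)) (fun κ x => by simp only [hb κ x, hup κ x]) hwc hpos
  have ht : ∀ x t, HasDerivAt (fun s => u (flow b s x))
      (inner ℝ (b (flow b t x)) (∇ u (flow b t x))) t := fun x t => by
    have := (hu.differentiable one_ne_zero (flow b t x)).hasFDerivAt.comp_hasDerivAt t
      (hasDerivAt_flow hb hc x t)
    refine this.congr_deriv ?_
    rw [real_inner_comm, inner_gradient_left]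
  have hmono : ∀ x, StrictMono fun s => u (flow b s x) := fun x =>
    (strictMono_and_exists_zero_of_le_deriv (ht x) hc0 fun t => hcle _).1
  choose τ hτ using fun x =>
    (strictMono_and_exists_zero_of_le_deriv (ht x) hc0 fun t => hcle _).2
  have hne : ∀ x, inner ℝ (b x) (∇ u x) ≠ 0 := fun x => (hc0.trans_le (hcle x)).ne'
  have hgrad := hasGradientAt_of_implicit (f := fun x t => u (flow b t x))
    (w := fun x t => inner ℝ (b (flow b t x)) (∇ u (flow b t x)))
    (Φ := fun x t => hitMap b u (t, x))
    (fun x t => hasGradientAt_comp_flow hb hc hu (hne _)) ht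
    (hwc.comp ((continuous_uncurry_flow hb hc).comp continuous_swap))
    (hΦ.continuous.comp continuous_swap) (fun x t => hne _) (fun x => (hmono x).injective) hτ
  refine ⟨fun x => -τ x, fun x => hitMap b u (τ x, x), hgrad, fun x => hC _, ?_, fun x => ?_⟩
  -- The bound on `Φ` makes `τ` Lipschitz, so `x ↦ Φ(τ(x), x)` inherits uniform continuity.
  · have hLip : LipschitzWith C.toNNReal fun x => -τ x :=
      lipschitzWith_of_nnnorm_fderiv_le (fun x => (hgrad x).differentiableAt) fun x => by
        rw [(hgrad x).hasFDerivAt.fderiv, ← NNReal.coe_le_coe, coe_nnnorm,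
          LinearIsometryEquiv.norm_map]
        exact (hC _).trans (Real.le_coe_toNNReal C)
    have := hLip.uniformContinuous.neg
    simp only [neg_neg] at this
    exact hΦ.comp (this.prodMk uniformContinuous_id)
  -- Starting further along the trajectory by `t` shortens the hitting time by `t`; differentiating
  -- at `t = 0` gives `b·∇v = 1`.
  · have hτt : ∀ t, -τ (flow b t x) = -τ x + t := fun t => by
      have : τ (flow b t x) = τ x - t := by
        refine (hmono (flow b t x)).injective ?_
        rw [hτ, ← flow_add hb hc, sub_add_cancel, hτ]
      rw [this]
      ring
    have h1 : HasDerivAt (fun t => -τ (flow b t x)) 1 0 := by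
      simp only [hτt]
      exact (hasDerivAt_id 0).const_add _
    have hx0 : HasFDerivAt (fun y => -τ y) (InnerProductSpace.toDual ℝ _ (hitMap b u (τ x, x)))
        (flow b 0 x) := by
      rw [flow_zero hb hc]
      exact (hgrad x).hasFDerivAt
    have h2 := hx0.comp_hasDerivAt 0 (hasDerivAt_flow hb hc x 0)
    have h3 := h2.unique h1
    rw [flow_zero hb hc, InnerProductSpace.toDual_apply_apply] at h3
    rw [real_inner_comm]
    exact h3

end HitTime

/-! ### Averaging over translations -/

theorem Ultrafilter.exists_tendsto_of_norm_le {ι E : Type*} [NormedAddCommGroup E] [ProperSpace E]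
    (U : Ultrafilter ι) {f : ι → E} {C : ℝ} (hf : ∀ i, ‖f i‖ ≤ C) :
    ∃ L, Filter.Tendsto f U (nhds L) := by
  obtain ⟨L, -, hL⟩ := (isCompact_closedBall (0 : E) C).ultrafilter_le_nhds (U.map f)
    (by
      rw [Ultrafilter.coe_map, Filter.le_principal_iff]
      exact Filter.mem_map.2 (Filter.univ_mem' fun i => by simpa using hf i))
  exact ⟨L, hL⟩

theorem norm_average_le {E : Type*} [NormedAddCommGroup E] [NormedSpace ℝ E] {a : ℕ → E} {C : ℝ}
    (hC : 0 ≤ C) (ha : ∀ j, ‖a j‖ ≤ C) (n : ℕ) :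
    ‖(n : ℝ)⁻¹ • ∑ j ∈ Finset.range n, a j‖ ≤ C := by
  have h : ‖∑ j ∈ Finset.range n, a j‖ ≤ n * C := by
    simpa using norm_sum_le_of_le (Finset.range n) fun j _ => ha j
  rw [norm_smul, norm_inv, Real.norm_natCast]
  rcases Nat.eq_zero_or_pos n with rfl | hn
  · simpa using hC
  · rw [inv_mul_le_iff₀ (by positivity)]
    exact h

section Average

variable {E : Type*} [NormedAddCommGroup E] [InnerProductSpace ℝ E]

/-- The radius `δ` does not depend on `x`, so the estimate holds for all translates at once and
survives averaging. -/
theorem uniform_linearization_of_gradient [CompleteSpace E] {v : E → ℝ} {g : E → E}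
    (hv : ∀ x, HasGradientAt v (g x) x) (hg : UniformContinuous g) {ε : ℝ} (hε : 0 < ε) :
    ∃ δ > 0, ∀ x y, dist y x < δ → |v y - v x - inner ℝ (g x) (y - x)| ≤ ε * ‖y - x‖ := by
  obtain ⟨δ, hδ, H⟩ := Metric.uniformContinuous_iff.1 hg ε hε
  refine ⟨δ, hδ, fun x y hy => ?_⟩
  have := (convex_ball x δ).norm_image_sub_le_of_norm_hasFDerivWithin_le' (f := v)
    (f' := fun z => InnerProductSpace.toDual ℝ E (g z)) (C := ε)
    (φ := InnerProductSpace.toDual ℝ E (g x))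
    (fun z _ => (hv z).hasFDerivAt.hasFDerivWithinAt)
    (fun z hz => by
      rw [← map_sub, LinearIsometryEquiv.norm_map, ← dist_eq_norm]
      exact (H hz).le)
    (Metric.mem_ball_self hδ) hy
  simpa using this

/-- The averages of a function along the translations by `e` have a generalized limit, which keeps
the bounds on the gradient and the product with an invariant field, and whose gradient is invariant
under the translation by `e`. -/
theorem exists_averaged_potential [ProperSpace E] [CompleteSpace E] {b : E → E} {e : E}
    (hb : ∀ x, b (x + e) = b x) {v : E → ℝ} {g : E → E} {C : ℝ}
    (hv : ∀ x, HasGradientAt v (g x) x) (hC : ∀ x, ‖g x‖ ≤ C) (hg : UniformContinuous g)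
    (hbg : ∀ x, inner ℝ (b x) (g x) = 1) :
    ∃ (v' : E → ℝ) (g' : E → E), (∀ x, HasGradientAt v' (g' x) x) ∧ (∀ x, ‖g' x‖ ≤ C) ∧
      UniformContinuous g' ∧ (∀ x, inner ℝ (b x) (g' x) = 1) ∧ (∀ x, g' (x + e) = g' x) ∧
      ∀ a, (∀ x, g (x + a) = g x) → ∀ x, g' (x + a) = g' x := by
  have hC0 : 0 ≤ C := (norm_nonneg _).trans (hC 0)
  have hbn : ∀ (j : ℕ) x, b (x + j • e) = b x := fun j => by
    induction j with
    | zero => simp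
    | succ j ih => intro x; rw [succ_nsmul, ← add_assoc, hb, ih]
  set G : ℕ → E → E := fun n x => (n : ℝ)⁻¹ • ∑ j ∈ Finset.range n, g (x + j • e) with hG
  -- Subtracting the value at the translated origin keeps the averages bounded by `C * ‖x‖`.
  set V : ℕ → E → ℝ := fun n x =>
    (n : ℝ)⁻¹ • ∑ j ∈ Finset.range n, (v (x + j • e) - v (0 + j • e)) with hV
  have hvLip : ∀ x y, |v y - v x| ≤ C * ‖y - x‖ := fun x y => by
    have := convex_univ.norm_image_sub_le_of_norm_hasFDerivWithin_le (f := v) (C := C)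
      (fun z _ => (hv z).hasFDerivAt.hasFDerivWithinAt)
      (fun z _ => by rw [LinearIsometryEquiv.norm_map]; exact hC z)
      (Set.mem_univ x) (Set.mem_univ y)
    simpa using this
  have hGb : ∀ n x, ‖G n x‖ ≤ C := fun n x => norm_average_le hC0 (fun j => hC _) n
  have hVb : ∀ n x, ‖V n x‖ ≤ C * ‖x‖ := fun n x =>
    norm_average_le (by positivity) (fun j => by
      have := hvLip (0 + j • e) (x + j • e)
      simpa using this) n
  -- One nonprincipal ultrafilter gives limits at all points simultaneously, without extracting
  -- subsequences.
  set U : Ultrafilter ℕ := Filter.hyperfilter ℕ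
  choose g' hg' using fun x => U.exists_tendsto_of_norm_le fun n => hGb n x
  choose v' hv' using fun x => U.exists_tendsto_of_norm_le fun n => hVb n x
  refine ⟨v', g', fun x => ?_, fun x => ?_, ?_, fun x => ?_, fun x => ?_, fun a ha x => ?_⟩
  · rw [hasGradientAt_iff_isLittleO, Asymptotics.isLittleO_iff]
    intro ε hε
    obtain ⟨δ, hδ, H⟩ := uniform_linearization_of_gradient hv hg hε
    filter_upwards [Metric.ball_mem_nhds x hδ] with y hy
    refine le_of_tendsto (((hv' y).sub (hv' x)).sub ((hg' x).inner tendsto_const_nhds)).norm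
      (Filter.Eventually.of_forall fun n => ?_)
    have e1 : V n y - V n x - inner ℝ (G n x) (y - x) = (n : ℝ)⁻¹ • ∑ j ∈ Finset.range n,
        (v (y + j • e) - v (x + j • e) - inner ℝ (g (x + j • e)) (y - x)) := by
      simp only [hV, hG, real_inner_smul_left, sum_inner, smul_eq_mul, ← mul_sub,
        ← Finset.sum_sub_distrib]
      congr 1
      refine Finset.sum_congr rfl fun j _ => by ring
    rw [e1]
    refine norm_average_le (by positivity) (fun j => ?_) n
    have := H (x + j • e) (y + j • e) (by simpa using hy)
    simpa using this
  · exact le_of_tendsto (hg' x).norm (Filter.Eventually.of_forall fun n => hGb n x)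
  · rw [Metric.uniformContinuous_iff]
    intro ε hε
    obtain ⟨δ, hδ, H⟩ := Metric.uniformContinuous_iff.1 hg (ε / 2) (by positivity)
    refine ⟨δ, hδ, fun x y hxy => ?_⟩
    refine lt_of_le_of_lt ?_ (half_lt_self hε)
    rw [dist_eq_norm]
    refine le_of_tendsto ((hg' x).sub (hg' y)).norm (Filter.Eventually.of_forall fun n => ?_)
    simp only [hG, ← smul_sub, ← Finset.sum_sub_distrib]
    refine norm_average_le (by positivity) (fun j => ?_) n
    rw [← dist_eq_norm]
    exact (H (by simpa using hxy)).le
  · refine tendsto_nhds_unique_of_eventuallyEq (tendsto_const_nhds.inner (hg' x))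
      (tendsto_const_nhds (x := (1 : ℝ))) ?_
    filter_upwards [Nat.hyperfilter_le_atTop (Filter.eventually_gt_atTop 0)] with n hn
    have : ∀ j, inner ℝ (b x) (g (x + j • e)) = 1 := fun j => by rw [← hbn j x, hbg]
    simp only [hG, real_inner_smul_right, inner_sum, this]
    have hn' : (n : ℝ) ≠ 0 := by exact_mod_cast hn.ne'
    simp [hn']
  · refine (sub_eq_zero.1 (tendsto_nhds_unique ((hg' (x + e)).sub (hg' x)) ?_))
    have h0 : Filter.Tendsto (fun n : ℕ => 2 * C / (n : ℝ)) U (nhds 0) :=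
      (tendsto_const_div_atTop_nhds_zero_nat _).mono_left Nat.hyperfilter_le_atTop
    refine squeeze_zero_norm (fun n => ?_) h0
    -- The sum telescopes, leaving two boundary terms of total size at most `2 * C / n`.
    have e1 : G n (x + e) - G n x = (n : ℝ)⁻¹ • (g (x + n • e) - g x) := by
      simp only [hG, ← smul_sub, ← Finset.sum_sub_distrib]
      have := Finset.sum_range_sub (fun j : ℕ => g (x + j • e)) n
      simp only [zero_smul, add_zero] at this
      rw [← this]
      congr 1
      refine Finset.sum_congr rfl fun j _ => ?_
      rw [succ_nsmul', add_assoc]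
    rw [e1, norm_smul, norm_inv, Real.norm_natCast, div_eq_inv_mul]
    gcongr
    linarith [norm_sub_le (g (x + n • e)) (g x), hC (x + n • e), hC x]
  · refine tendsto_nhds_unique (hg' (x + a)) ?_
    convert hg' x using 2 with n
    simp only [hG]
    congr 1
    refine Finset.sum_congr rfl fun j _ => ?_
    rw [add_right_comm, ha]

end Average

/-! ### From a bounded gradient to a periodic one -/

section Periodic

variable {d : ℕ}

/-- Periodicity may be checked on the basis of the lattice. -/
theorem yPeriodic_of_single {F : Type*} {f : Eucl d → F}
    (h : ∀ i x, f (x + EuclideanSpace.single i (1 : ℝ)) = f x) : YPeriodic f := by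
  have hsub : ∀ i x, f (x - EuclideanSpace.single i (1 : ℝ)) = f x := fun i x => by
    rw [← h i, sub_add_cancel]
  have hz : ∀ (i : Fin d) (n : ℤ) x, f (x + n • EuclideanSpace.single i (1 : ℝ)) = f x := by
    intro i n
    induction n using Int.induction_on with
    | zero => simp
    | succ n ih => intro x; rw [add_zsmul, one_zsmul, ← add_assoc, h, ih]
    | pred n ih => intro x; rw [sub_zsmul, one_zsmul, ← add_assoc, ← sub_eq_add_neg, hsub, ih]
  intro κ
  have hκ : latticeVec κ = ∑ i, κ i • EuclideanSpace.single i (1 : ℝ) := by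
    ext j
    simp [latticeVec, Finset.sum_apply, Pi.single_apply]
  rw [hκ]
  have : ∀ s : Finset (Fin d), ∀ x, f (x + ∑ i ∈ s, κ i • EuclideanSpace.single i (1 : ℝ)) = f x := by
    intro s
    induction s using Finset.induction_on with
    | empty => simp
    | insert i s hi ih =>
      intro x
      rw [Finset.sum_insert hi, add_left_comm, add_comm, hz, ih]
  exact this _

theorem latticeVec_single (i : Fin d) :
    latticeVec (Pi.single i 1) = EuclideanSpace.single i (1 : ℝ) := by
  ext j
  by_cases h : j = i
  · subst h; simp [latticeVec]
  · simp [latticeVec, h]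

/-- Averaging is done in one coordinate direction at a time; translations commute, so each step
keeps the invariance already gained. -/
theorem exists_isGradientInverse_of_bounded {b : Eucl d → Eucl d} (hb : YPeriodic b)
    {v : Eucl d → ℝ} {g : Eucl d → Eucl d} {C : ℝ}
    (hv : ∀ x, HasGradientAt v (g x) x) (hC : ∀ x, ‖g x‖ ≤ C) (hg : UniformContinuous g)
    (hbg : ∀ x, inner ℝ (b x) (g x) = 1) : ∃ v₁, IsGradientInverse b v₁ := by
  have key : ∀ s : Finset (Fin d), ∃ (v' : Eucl d → ℝ) (g' : Eucl d → Eucl d),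
      (∀ x, HasGradientAt v' (g' x) x) ∧ (∀ x, ‖g' x‖ ≤ C) ∧ UniformContinuous g' ∧
      (∀ x, inner ℝ (b x) (g' x) = 1) ∧
      ∀ i ∈ s, ∀ x, g' (x + EuclideanSpace.single i (1 : ℝ)) = g' x := by
    intro s
    induction s using Finset.induction_on with
    | empty => exact ⟨v, g, hv, hC, hg, hbg, by simp⟩
    | insert i s _ ih =>
      obtain ⟨v₁, g₁, h1, h2, h3, h4, h5⟩ := ih
      obtain ⟨v₂, g₂, k1, k2, k3, k4, k5, k6⟩ := exists_averaged_potential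
        (e := EuclideanSpace.single i (1 : ℝ))
        (fun x => by rw [← latticeVec_single]; exact hb _ x) h1 h2 h3 h4
      refine ⟨v₂, g₂, k1, k2, k3, k4, fun j hj => ?_⟩
      rcases Finset.mem_insert.1 hj with rfl | hj
      · exact k5
      · exact k6 _ (h5 j hj)
  obtain ⟨v₁, g₁, h1, -, h3, h4, h5⟩ := key Finset.univ
  have hgr : ∇ v₁ = g₁ := gradient_eq h1
  refine ⟨v₁, contDiff_one_iff_fderiv.2 ⟨fun x => (h1 x).differentiableAt, ?_⟩, ?_, ?_⟩
  · rw [← toDual_comp_gradient, hgr]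
    exact (InnerProductSpace.toDual ℝ _).continuous.comp h3.continuous
  · rw [hgr]
    exact yPeriodic_of_single fun i => h5 i (Finset.mem_univ i)
  · rw [hgr]
    exact h4

end Periodic

/-! ### A component depending on its own coordinate -/

theorem exists_isGradientInverse_of_component {d : ℕ} {b : Eucl d → Eucl d} (hc : Continuous b)
    (hb : YPeriodic b) {k : Fin d} {β : ℝ → ℝ} (h : ∀ x, b x k = β (x k) ∧ 0 < b x k) :
    ∃ v₁, IsGradientInverse b v₁ := by
  have hβ : ∀ s, β s = b (EuclideanSpace.single k s) k := fun s => by rw [(h _).1]; simp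
  have hβc : Continuous β := by
    rw [funext hβ]
    have hs : Continuous fun s : ℝ => (EuclideanSpace.single k s : Eucl d) :=
      (PiLp.continuous_toLp 2 _).comp (continuous_single (A := fun _ : Fin d => ℝ) k)
    exact (EuclideanSpace.proj (𝕜 := ℝ) k).continuous.comp (hc.comp hs)
  have hβ0 : ∀ s, β s ≠ 0 := fun s => by rw [hβ]; exact (h _).2.ne'
  set g : Eucl d → Eucl d := fun x => (β (x k))⁻¹ • EuclideanSpace.single k (1 : ℝ) with hg
  have hgrad : ∀ x, HasGradientAt (fun x : Eucl d => ∫ s in (0 : ℝ)..x k, (β s)⁻¹) (g x) x := by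
    intro x
    have h1 := ((hβc.inv₀ hβ0).integral_hasStrictDerivAt 0 (x k)).hasDerivAt
    have h2 := h1.hasFDerivAt.comp x (EuclideanSpace.proj (𝕜 := ℝ) k).hasFDerivAt
    rw [hasGradientAt_iff_hasFDerivAt]
    refine h2.congr_fderiv ?_
    ext y
    simp [hg, EuclideanSpace.inner_single_left, mul_comm]
  have hgr := gradient_eq hgrad
  have hgc : Continuous g :=
    ((hβc.comp (EuclideanSpace.proj (𝕜 := ℝ) k).continuous).inv₀ fun x => hβ0 _).smul
      continuous_const
  refine ⟨_, contDiff_one_iff_fderiv.2 ⟨fun x => (hgrad x).differentiableAt, ?_⟩, ?_, fun x => ?_⟩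
  · rw [← toDual_comp_gradient, hgr]
    exact (InnerProductSpace.toDual ℝ _).continuous.comp hgc
  · rw [hgr]
    intro κ x
    simp only [hg]
    rw [← (h _).1, ← (h x).1, hb κ x]
  · rw [hgr]
    simp only [hg, real_inner_smul_right, EuclideanSpace.inner_single_right]
    simp [(h x).1, hβ0]

/-! ### Gradients close to the canonical basis -/

/-- The set `{ε < ‖f‖}` is open, null in the cell and hence, by translation, null everywhere; an
open null set is empty. -/
theorem YPeriodic.norm_le_of_eLpNorm_lt {d : ℕ} {f : Eucl d → Eucl d} (hf : YPeriodic f)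
    (hc : Continuous f) {ε : ℝ}
    (h : MeasureTheory.eLpNorm f ∞ (MeasureTheory.volume.restrict (unitCell d))
      < ENNReal.ofReal ε) (x : Eucl d) : ‖f x‖ ≤ ε := by
  have hε : 0 < ε := ENNReal.ofReal_pos.1 (pos_of_gt h)
  set S : Set (Eucl d) := {x | ε < ‖f x‖} with hS
  have hSo : IsOpen S := isOpen_lt continuous_const hc.norm
  have hS0 : MeasureTheory.volume (S ∩ unitCell d) = 0 := by
    rw [← MeasureTheory.Measure.restrict_apply hSo.measurableSet]
    rw [MeasureTheory.eLpNorm_exponent_top] at h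
    refine MeasureTheory.measure_mono_null (fun y hy => ?_)
      (MeasureTheory.ae_iff.1 (ae_lt_of_essSup_lt h))
    change ¬ ‖f y‖ₑ < ENNReal.ofReal ε
    rw [not_lt, ← ofReal_norm]
    exact ENNReal.ofReal_le_ofReal (le_of_lt hy)
  have hSall : MeasureTheory.volume S = 0 := by
    refine MeasureTheory.measure_mono_null (t := ⋃ κ : Fin d → ℤ,
      (fun x => x + latticeVec κ) ⁻¹' (S ∩ unitCell d)) (fun y hy => ?_)
      (MeasureTheory.measure_iUnion_null fun κ => by
        rw [MeasureTheory.measure_preimage_add_right, hS0])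
    refine Set.mem_iUnion.2 ⟨fun i => -⌊y i⌋, ?_, fun i => ?_⟩
    · change ε < ‖f _‖
      rw [hf]
      exact hy
    · have : (y + latticeVec fun i => -⌊y i⌋) i = Int.fract (y i) := by
        simp [latticeVec, Int.fract, sub_eq_add_neg]
      change (y + latticeVec fun i => -⌊y i⌋) i ∈ _
      rw [this]
      exact ⟨Int.fract_nonneg _, Int.fract_lt_one _⟩
  have hSe : S = ∅ := hSo.measure_eq_zero_iff _ |>.1 hSall
  by_contra hx
  exact (Set.mem_empty_iff_false x).1 (hSe ▸ (not_le.1 hx : x ∈ S))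

theorem continuous_colMatrix {d : ℕ} : Continuous (colMatrix : (Fin d → Eucl d) → _) := by
  refine continuous_matrix fun i j => ?_
  exact (EuclideanSpace.proj (𝕜 := ℝ) i).continuous.comp (continuous_apply j)

theorem exists_det_colMatrix_pos (d : ℕ) : ∃ δ > 0, ∀ ξ : Fin d → Eucl d,
    (∀ k, ‖ξ k - EuclideanSpace.single k (1 : ℝ)‖ < δ) → 0 < (colMatrix ξ).det := by
  have h1 : (colMatrix fun k : Fin d => EuclideanSpace.single k (1 : ℝ)) = 1 := by
    ext i j
    simp [colMatrix, Matrix.one_apply]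
  have hcont : Continuous fun ξ : Fin d → Eucl d => (colMatrix ξ).det :=
    continuous_colMatrix.matrix_det
  have hev : ∀ᶠ ξ in nhds fun k : Fin d => (EuclideanSpace.single k (1 : ℝ) : Eucl d),
      0 < (colMatrix ξ).det :=
    hcont.continuousAt.eventually_const_lt (by simp [h1])
  obtain ⟨δ, hδ, H⟩ := Metric.eventually_nhds_iff.1 hev
  exact ⟨δ, hδ, fun ξ hξ => H ((dist_pi_lt_iff hδ).2 fun k => by
    rw [dist_eq_norm]; exact hξ k)⟩

/-- In the expansion along the first column the minors do not involve `ζ`, so the determinant is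
linear in `ζ`, with the coordinates of the cross product as coefficients. -/
theorem inner_crossProd {n : ℕ} (ζ : Eucl (n + 1)) (ξ : Fin n → Eucl (n + 1)) :
    inner ℝ (crossProd ξ) ζ = (colMatrix (Fin.cons ζ ξ : Fin (n + 1) → Eucl (n + 1))).det := by
  have hsub : ∀ (ζ' : Eucl (n + 1)) (i : Fin (n + 1)),
      (colMatrix (Fin.cons ζ' ξ : Fin (n + 1) → Eucl (n + 1))).submatrix i.succAbove Fin.succ =
        Matrix.of fun r c => ξ c (i.succAbove r) := fun ζ' i => by
    ext r c
    simp [colMatrix]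
  rw [PiLp.inner_apply]
  simp only [crossProd, Matrix.det_succ_column_zero, hsub]
  refine Finset.sum_congr rfl fun i _ => ?_
  rw [Finset.sum_eq_single i]
  · simp [colMatrix]; ring
  · intro j _ hj
    simp [colMatrix, hj]
  · simp

theorem inner_perpProd {m : ℕ} (ζ : Eucl (m + 2)) (ξ : Fin (m + 1) → Eucl (m + 2)) :
    inner ℝ (perpProd ξ) ζ = (colMatrix (Fin.cons ζ ξ : Fin (m + 2) → Eucl (m + 2))).det := by
  cases m with
  | zero =>
    rw [PiLp.inner_apply, Matrix.det_fin_two]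
    simp [perpProd, rotPerp, colMatrix]
    ring
  | succ m => exact inner_crossProd ζ ξ

theorem continuous_crossProd {n : ℕ} :
    Continuous (crossProd : (Fin n → Eucl (n + 1)) → Eucl (n + 1)) := by
  refine (PiLp.continuous_toLp 2 _).comp (continuous_pi fun k => ?_)
  exact (continuous_colMatrix.comp (continuous_const.finCons continuous_id)).matrix_det

theorem continuous_perpProd {m : ℕ} :
    Continuous (perpProd : (Fin (m + 1) → Eucl (m + 2)) → Eucl (m + 2)) := by
  cases m with
  | zero =>
    have h : ∀ i : Fin 2, Continuous fun ξ : Fin 1 → Eucl 2 => ξ 0 i := fun i =>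
      (EuclideanSpace.proj (𝕜 := ℝ) i).continuous.comp (continuous_apply (0 : Fin 1))
    refine (PiLp.continuous_toLp 2 _).comp (continuous_pi fun i => ?_)
    fin_cases i
    · exact h 1
    · exact (h 0).neg
  | succ m => exact continuous_crossProd

theorem isGradientInverse_of_perpProd {m : ℕ} {v : Fin (m + 2) → Eucl (m + 2) → ℝ}
    (hv : ∀ k, ContDiff ℝ 1 (v k)) (hp : ∀ k, YPeriodic (∇ (v k)))
    (hσ : ∀ x, 0 < (colMatrix fun k => ∇ (v k) x).det) {b : Eucl (m + 2) → Eucl (m + 2)}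
    (hb : ∀ x, (colMatrix fun k => ∇ (v k) x).det • b x =
      perpProd fun j : Fin (m + 1) => ∇ (v j.succ) x) :
    Continuous b ∧ YPeriodic b ∧ IsGradientInverse b (v 0) := by
  have hgc : ∀ k, Continuous (∇ (v k)) := fun k =>
    (InnerProductSpace.toDual ℝ _).symm.continuous.comp ((hv k).continuous_fderiv one_ne_zero)
  have hb' : b = fun x => ((colMatrix fun k => ∇ (v k) x).det)⁻¹ •
      perpProd fun j : Fin (m + 1) => ∇ (v j.succ) x := by
    funext x
    rw [← hb x, inv_smul_smul₀ (hσ x).ne']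
  refine ⟨?_, ?_, hv 0, hp 0, fun x => ?_⟩
  · rw [hb']
    refine Continuous.smul (Continuous.inv₀ ?_ fun x => (hσ x).ne') ?_
    · exact (continuous_colMatrix.comp (continuous_pi hgc)).matrix_det
    · exact continuous_perpProd.comp (continuous_pi fun j => hgc j.succ)
  · rw [hb']
    intro κ x
    simp only [fun k => hp k κ x]
  · have h1 := inner_perpProd (∇ (v 0) x) fun j : Fin (m + 1) => ∇ (v j.succ) x
    have h2 : (Fin.cons (∇ (v 0) x) fun j : Fin (m + 1) => ∇ (v j.succ) x) =
        (fun k => ∇ (v k) x : Fin (m + 2) → Eucl (m + 2)) :=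
      Fin.cons_self_tail fun k => ∇ (v k) x
    rw [h2, ← hb x, real_inner_smul_left] at h1
    exact mul_left_cancel₀ (hσ x).ne' (h1.trans (mul_one _).symm)

theorem proposition3p5 :
    -- (i) some component of `b` is positive and depends on its own coordinate only
    (∀ (d : ℕ) (b : Eucl d → Eucl d), Continuous b → YPeriodic b →
      (∃ (k : Fin d) (β : ℝ → ℝ), ∀ x, b x k = β (x k) ∧ 0 < b x k) →
      ∃ v₁ : Eucl d → ℝ, IsGradientInverse b v₁) ∧
    -- (ii) the map `Φ` is bounded and uniformly continuous in `ℝ × ℝ^d`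
    (∀ (d : ℕ) (b : Eucl d → Eucl d), ContDiff ℝ 1 b → YPeriodic b →
      (∃ u : Eucl d → ℝ, ContDiff ℝ 1 u ∧ YPeriodic (∇ u) ∧
        (∀ x ∈ unitCell d, 0 < inner ℝ (b x) (∇ u x)) ∧
        (∃ C : ℝ, ∀ p, ‖hitMap b u p‖ ≤ C) ∧ UniformContinuous (hitMap b u)) →
      ∃ v₁ : Eucl d → ℝ, IsGradientInverse b v₁) ∧
    -- (iii) dimension `d = m + 2`; `v 0, …, v (m + 1)` are the functions `v_1, …, v_d`
    (∀ m : ℕ, ∃ ε₀ : ℝ, 0 < ε₀ ∧ ∀ ε : ℝ, 0 < ε → ε < ε₀ →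
      ∀ v : Fin (m + 2) → Eucl (m + 2) → ℝ,
        (∀ k, ContDiff ℝ 1 (v k) ∧ YPeriodic (∇ (v k)) ∧
          MeasureTheory.eLpNorm (fun x => ∇ (v k) x - EuclideanSpace.single k (1 : ℝ)) ∞
            (MeasureTheory.volume.restrict (unitCell (m + 2))) < ENNReal.ofReal ε) →
        (∀ x, 0 < (colMatrix fun k => ∇ (v k) x).det) ∧
        ∀ b : Eucl (m + 2) → Eucl (m + 2),
          (∀ x, (colMatrix fun k => ∇ (v k) x).det • b x =
            perpProd fun j : Fin (m + 1) => ∇ (v j.succ) x) →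
          Continuous b ∧ YPeriodic b ∧ IsGradientInverse b (v 0)) := by
  refine ⟨fun d b hc hb ⟨k, β, h⟩ => exists_isGradientInverse_of_component hc hb h,
    fun d b hc hb ⟨u, hu, hup, hpos, ⟨C, hC⟩, hΦ⟩ => ?_, fun m => ?_⟩
  · obtain ⟨v, g, h1, h2, h3, h4⟩ := exists_potential_of_hitMap hc hb hu hup hpos hC hΦ
    exact exists_isGradientInverse_of_bounded hb h1 h2 h3 h4
  · obtain ⟨δ, hδ, H⟩ := exists_det_colMatrix_pos (m + 2)
    -- `ε₀` is the radius around the canonical basis on which the determinant stays positive, so it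
    -- depends on the dimension only.
    refine ⟨δ, hδ, fun ε _ hεδ v hv => ?_⟩
    have hgc : ∀ k, Continuous (∇ (v k)) := fun k =>
      (InnerProductSpace.toDual ℝ _).symm.continuous.comp
        ((hv k).1.continuous_fderiv one_ne_zero)
    have hσ : ∀ x, 0 < (colMatrix fun k => ∇ (v k) x).det := fun x => H _ fun k => by
      have hper : YPeriodic fun x => ∇ (v k) x - EuclideanSpace.single k (1 : ℝ) := fun κ x => by
        simp only [(hv k).2.1 κ x]
      exact (hper.norm_le_of_eLpNorm_lt ((hgc k).sub continuous_const) (hv k).2.2 x).trans_lt hεδ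
    exact ⟨hσ, fun b hb =>
      isGradientInverse_of_perpProd (fun k => (hv k).1) (fun k => (hv k).2.1) hσ hb⟩
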